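/- \textbf{Model.} There are $N$ chargers. At stage $t=0,1,2,\dots$ the state of charger $i$ is $x_{i,t}=(\lambda_{i,t},\gamma_{i,t})$ with integers $0\le\lambda_{i,t}\le B$ and $0\le\gamma_{i,t}\le E$. If $\lambda_{i,t}\ge 1$, a vehicle (called vehicle $i$) is connected, $\lambda_{i,t}$ is the number of stages before it departs and $\gamma_{i,t}$ its remaining processing time; an empty charger has state $(0,0)$. The system state $\mathbf x_t$ consists of the charger states, a grid state $s_t$ in a finite set $\mathcal S$ and a demand state $d_t$ in a finite set $\mathcal D$; $\mathcal X$ is the set of all system states. An action $\mathbf a\in\{0,1\}^N$ is feasible at $\mathbf x$ if $a_i\le\gamma_i$ for all $i$; put $A=\sum_i a_i$. Given $\mathbf x_t$ and $\mathbf a_t$, the next grid state has a law depending only on $(s_t,A_t)$ and, independently of it, the next demand state and the finite batch of vehicles arriving at stage $t+1$ (each with an initial state in $\{1,\dots,B\}\times\{0,\dots,E\}$) have a joint law depending only on $d_t$. A vehicle with $\lambda_{i,t}\ge 2$ moves to $(\lambda_{i,t}-1,\gamma_{i,t}-a_{i,t})$; one with $\lambda_{i,t}=1$ leaves at the beginning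 of stage $t+1$. Arriving vehicles are connected to chargers that are empty or being vacated ($\lambda_{i,t}\le 1$), by an arbitrary, possibly randomized, rule that depends only on the batch and on $(\lambda_{1,t},\dots,\lambda_{N,t})$; a charger to which no vehicle is connected is empty. The stage cost is $$g(\mathbf x,\mathbf a)=C(A,s)+\sum_{j:\,\lambda_j=1}q(\gamma_j-a_j),$$ with $C$ real-valued, $q:\{0,1,2,\dots\}\to[0,\infty)$ and $q(0)=0$. A feasible policy is a sequence $\pi=(\nu_0,\nu_1,\dots)$ of maps from $\mathcal X$ to actions with $\nu_t(\mathbf x)$ feasible at $\mathbf x$ for all $t$ and $\mathbf x$. Its average cost from $\mathbf x_0$ is $$J_\pi(\mathbf x_0)=\limsup_{T\to\infty}\frac1T\,\mathbb E_\pi\Big[\sum_{t=0}^{T-1}g(\mathbf x_t,\nu_t(\mathbf x_t))\Big].$$ A stationary policy is $\pi=(\mu,\mu,\dots)$; it is optimal if it is feasible and $J_\mu(\mathbf x)\le J_\pi(\mathbf x)$ for every feasible policy $\pi$ and every $\mathbf x\in\mathcal X$. The laxity of vehicle $i$ is $\theta_i=\lambda_i-\gamma_i$ if $\gamma_i>0$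 and $\theta_i=B$ if $\gamma_i=0$. For two connected vehicles, $i\preccurlyeq j$ at $\mathbf x$ means that $\theta_i\ge\theta_j$ and $\gamma_i\le\gamma_j$, with at least one of the two inequalities strict. \textbf{Theorem.} Assume: (1) $0\le q(n)-q(n-1)\le q(n+1)-q(n)$ for all $n\ge1$; (2) for every $d\in\mathcal D$, given $d_t=d$, with positive probability no vehicle arrives at stage $t+1$; (3) there are $\bar s\in\mathcal S$ and a positive integer $m$ such that, from every initial grid state and under zero aggregate charging $A_0=\dots=A_{m-1}=0$, the state $\bar s$ is visited with positive probability within the first $m$ steps; (4) $\{d_t\}$ is an ergodic (that is, irreducible; aperiodicity is not needed) Markov chain. Then there is an optimal stationary policy $\mu^*$ such that, at every $\mathbf x\in\mathcal X$, if the $i$th component of $\mu^*(\mathbf x)$ is $1$, then for every vehicle $j$ with $i\preccurlyeq j$ at $\mathbf x$ the $j$th component of $\mu^*(\mathbf x)$ is also $1$. -/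

import Mathlib

namespace EVCharging

/-- State `(λ, γ)` of a charger: `λ ≤ B` remaining stages before departure and remaining
processing time `γ ≤ E`. The charger is empty iff `λ = 0`, and then its state is `(0, 0)`. -/
abbrev ChargerState (B E : ℕ) : Type :=
  {v : Fin (B + 1) × Fin (E + 1) // v.1 = 0 → v.2 = 0}

/-- Remaining number of stages `λ`. -/
def ChargerState.stay {B E : ℕ} (v : ChargerState B E) : ℕ := (v.1.1 : ℕ)

/-- Remaining processing time `γ`. -/
def ChargerState.need {B E : ℕ} (v : ChargerState B E) : ℕ := (v.1.2 : ℕ)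

/-- The state `(0, 0)` of an empty charger. -/
def ChargerState.empty {B E : ℕ} : ChargerState B E := ⟨(0, 0), fun _ => rfl⟩

/-- Initial state of an arriving vehicle: it stays between `1` and `B` stages, and its processing
time is at most `E`. -/
abbrev Request (B E : ℕ) : Type := {v : ChargerState B E // 1 ≤ v.stay}

/-- An action: `a i = 1` iff vehicle `i` is charged. -/
abbrev Action (N : ℕ) : Type := Fin N → Fin 2

/-- The aggregate action `A`, the number of charged vehicles. -/
def Action.total {N : ℕ} (a : Action N) : ℕ := ∑ i, (a i : ℕ)

/-- A system state: the states of the `N` chargers, the state of grid, the state of demand. -/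
abbrev SystemState (N B E : ℕ) (S D : Type*) : Type _ := (Fin N → ChargerState B E) × S × D

/-- The data of the charging problem. -/
structure Model (N B E : ℕ) (S D : Type*) where
  /-- Law of the next state of grid, given the aggregate action and the current state of grid. -/
  grid : ℕ → S → PMF S
  /-- Charging cost `C(A, s)`. -/
  chargingCost : ℕ → S → ℝ
  /-- Joint law, given the current state of demand, of the next state of demand and of the batch
  of vehicles arriving at the next stage. -/
  demand : D → PMF (D × Multiset (Request B E))
  /-- Admission rule (possibly randomized): which arriving vehicles are connected to which
  chargers, given the remaining stays of the vehicles present and the arriving batch. -/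
  connect : (Fin N → ℕ) → Multiset (Request B E) → PMF (Fin N → Option (Request B E))
  /-- A vehicle is only connected to a charger that is empty or being vacated. -/
  connect_free : ∀ l b, ∀ c ∈ (connect l b).support, ∀ i, c i ≠ none → l i ≤ 1
  /-- The vehicles that get connected are among the arriving ones. -/
  connect_le : ∀ l b, ∀ c ∈ (connect l b).support, Finset.univ.val.filterMap c ≤ b
  /-- Non-completion penalty `q`. -/
  penalty : ℕ → ℝ
  penalty_nonneg : ∀ n, 0 ≤ penalty n
  penalty_zero : penalty 0 = 0

/-- Evolution of a charger without a new arrival: a vehicle with `λ ≥ 2` moves to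
`(λ - 1, γ - a)`; a vehicle with `λ = 1` leaves, and an empty charger stays empty. -/
def ChargerState.evolve {B E : ℕ} (v : ChargerState B E) (a : Fin 2) : ChargerState B E :=
  if h : 2 ≤ v.stay then
    ⟨(⟨v.stay - 1, by have := v.1.1.2; unfold ChargerState.stay; omega⟩,
      ⟨v.need - (a : ℕ), by have := v.1.2.2; unfold ChargerState.need; omega⟩), by
        intro h0
        have h1 := congrArg Fin.val h0
        simp only [Fin.val_zero] at h1
        omega⟩
  else ChargerState.empty

/-- State of a charger at the next stage, given the vehicle (if any) that gets connected to it. -/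
def ChargerState.next {B E : ℕ} (v : ChargerState B E) (a : Fin 2) :
    Option (Request B E) → ChargerState B E
  | none => v.evolve a
  | some r => r.1

/-- `U(x)`: an action is feasible at `x` if `a i ≤ γ i` for every charger `i`. -/
def Feasible {N B E : ℕ} {S D : Type*} (x : SystemState N B E S D) (a : Action N) : Prop :=
  ∀ i, (a i : ℕ) ≤ (x.1 i).need

/-- Laxity: `λ - γ` if `γ > 0`, and `B` if `γ = 0`. -/
def ChargerState.laxity {B E : ℕ} (v : ChargerState B E) : ℤ :=
  if 0 < v.need then (v.stay : ℤ) - (v.need : ℤ) else (B : ℤ)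

/-- `i ≼ j`: both chargers hold a vehicle, and vehicle `j` has less laxity and longer remaining
processing time than vehicle `i`, at least one of the two strictly. -/
def Priority {N B E : ℕ} {S D : Type*} (x : SystemState N B E S D) (i j : Fin N) : Prop :=
  0 < (x.1 i).stay ∧ 0 < (x.1 j).stay ∧
    (x.1 j).laxity ≤ (x.1 i).laxity ∧ (x.1 i).need ≤ (x.1 j).need ∧
    ((x.1 j).laxity < (x.1 i).laxity ∨ (x.1 i).need < (x.1 j).need)

/-- Law at time `t` of the time-homogeneous Markov chain with kernel `P` started at `a`. -/
noncomputable def chainLaw {α : Type*} (P : α → PMF α) (a : α) : ℕ → PMF α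
  | 0 => PMF.pure a
  | t + 1 => (chainLaw P a t).bind P

/-- A policy is a sequence of decision rules. -/
abbrev Policy (N B E : ℕ) (S D : Type*) : Type _ := ℕ → SystemState N B E S D → Action N

namespace Model

variable {N B E : ℕ} {S D : Type*} (M : Model N B E S D)

/-- Law of the next system state: grid and demand (with arrivals) evolve independently. -/
noncomputable def step (x : SystemState N B E S D) (a : Action N) :
    PMF (SystemState N B E S D) :=
  (M.grid a.total x.2.1).bind fun s' =>
    (M.demand x.2.2).bind fun db =>
      (M.connect (fun i => (x.1 i).stay) db.2).map fun c =>
        (fun i => (x.1 i).next (a i) (c i), s', db.1)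

/-- Stage cost: the charging cost plus the penalties of the vehicles about to leave. -/
def stageCost (x : SystemState N B E S D) (a : Action N) : ℝ :=
  M.chargingCost a.total x.2.1 +
    ∑ j with (x.1 j).stay = 1, M.penalty ((x.1 j).need - (a j : ℕ))

/-- Law of the system state at stage `t` under the policy `π`, from the initial state `x₀`. -/
noncomputable def stateLaw (π : Policy N B E S D) (x₀ : SystemState N B E S D) :
    ℕ → PMF (SystemState N B E S D)
  | 0 => PMF.pure x₀
  | t + 1 => (stateLaw π x₀ t).bind fun x => M.step x (π t x)

/-- Expected total cost over the stages `0, …, T - 1`. -/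
noncomputable def expectedCost [Fintype S] [Fintype D] (π : Policy N B E S D)
    (x₀ : SystemState N B E S D) (T : ℕ) : ℝ :=
  ∑ t ∈ Finset.range T, ∑ x, (M.stateLaw π x₀ t x).toReal * M.stageCost x (π t x)

/-- Time-averaged cost `J_π(x₀)`. -/
noncomputable def averageCost [Fintype S] [Fintype D] (π : Policy N B E S D)
    (x₀ : SystemState N B E S D) : ℝ :=
  Filter.limsup (fun T : ℕ => 1 / (T : ℝ) * M.expectedCost π x₀ T) Filter.atTop

/-- The stationary policy `(μ, μ, …)` is feasible, and from every initial state its average cost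
is minimal among all feasible policies, stationary or not. -/
def IsOptimalStationary [Fintype S] [Fintype D] (μ : SystemState N B E S D → Action N) : Prop :=
  (∀ x, Feasible x (μ x)) ∧
    ∀ π : Policy N B E S D, (∀ t x, Feasible x (π t x)) →
      ∀ x, M.averageCost (fun _ => μ) x ≤ M.averageCost π x

/-- The increments of the penalty are non-negative and non-decreasing. -/
def ConvexPenalty : Prop :=
  ∀ n, 0 ≤ M.penalty (n + 1) - M.penalty n ∧
    M.penalty (n + 1) - M.penalty n ≤ M.penalty (n + 2) - M.penalty (n + 1)

/-- In every state of demand, with positive probability no vehicle arrives at the next stage. -/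
def NoArrivalPossible : Prop :=
  ∀ d, 0 < (M.demand d).map Prod.snd 0

/-- Under zero aggregate charging, some state of grid is visited with positive probability within
the first `m` steps, from every initial state of grid. -/
def GridReachable : Prop :=
  ∃ s' : S, ∃ m : ℕ, 0 < m ∧ ∀ s, ∃ k ≤ m, 0 < chainLaw (M.grid 0) s k s'

/-- The Markov chain of the states of demand is ergodic, in the sense of irreducible: every state
is reached from every state with positive probability. Aperiodicity is not required. -/
def DemandErgodic : Prop :=
  ∀ d d' : D, ∃ k, 0 < chainLaw (fun e => (M.demand e).map Prod.fst) d k d'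

end Model

end EVCharging

/-! The interchange argument is run on auxiliary problems that stop with probability `1 - b` after
each transition and then pay `M.potential`. Discounting alone would weigh late penalties less than
early ones and spoil the comparison of vehicles that leave at different times; this terminal cost
charges an unfinished unit whether its vehicle departs or the process stops.

The invariant is `shiftMonotone`: inequalities comparing the cost-to-go at states whose needs differ
by one unit at one or two chargers. The two one-charger inequalities are what remains of the
two-charger one after one of the vehicles has left. By convexity of the penalty the potential
satisfies them, and the Bellman operator preserves them (`exists_actionValue_add_le_of_shift`),
since both states can be driven by the same noise. Hence the value of each stopped problem satisfies
them, and some greedy policy respects priorities.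

There are finitely many stationary policies, so one of them is greedy for values of `b` tending to
1. For any policy, `(1 - b) * V x₀` is at most the slope of its costs up to `O(1 - b)`; for the
greedy stationary policy the reverse bound holds, because its expected costs are linear in time up
to a bounded error. Letting `b` tend to 1 gives optimality. -/

namespace EVCharging

open Filter Topology

/-! ### Expectations on finite types -/

section Expectation

variable {α β : Type*} [Fintype α] [Fintype β]

/-- Expectation of a real function on a finite type. -/
noncomputable def expect (p : PMF α) (f : α → ℝ) : ℝ := ∑ x, (p x).toReal * f x

lemma sum_toReal_pmf (p : PMF α) : ∑ x, (p x).toReal = 1 := by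
  rw [← ENNReal.toReal_sum fun x _ => p.apply_ne_top x, ← tsum_fintype (L := .unconditional _),
    p.tsum_coe, ENNReal.toReal_one]

lemma expect_const (p : PMF α) (c : ℝ) : expect p (fun _ => c) = c := by
  simp [expect, ← Finset.sum_mul, sum_toReal_pmf]

lemma expect_add (p : PMF α) (f g : α → ℝ) :
    expect p (fun x => f x + g x) = expect p f + expect p g := by
  simp [expect, mul_add, Finset.sum_add_distrib]

lemma expect_sub (p : PMF α) (f g : α → ℝ) :
    expect p (fun x => f x - g x) = expect p f - expect p g := by
  simp [expect, mul_sub, Finset.sum_sub_distrib]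

lemma expect_const_mul (p : PMF α) (c : ℝ) (f : α → ℝ) :
    expect p (fun x => c * f x) = c * expect p f := by
  simp only [expect, Finset.mul_sum]
  exact Finset.sum_congr rfl fun x _ => by ring

lemma expect_mono_support (p : PMF α) {f g : α → ℝ} (h : ∀ x ∈ p.support, f x ≤ g x) :
    expect p f ≤ expect p g := by
  refine Finset.sum_le_sum fun x _ => ?_
  by_cases hx : x ∈ p.support
  · exact mul_le_mul_of_nonneg_left (h x hx) ENNReal.toReal_nonneg
  · simp [(PMF.apply_eq_zero_iff p x).2 hx]

lemma expect_mono (p : PMF α) {f g : α → ℝ} (h : ∀ x, f x ≤ g x) : expect p f ≤ expect p g :=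
  expect_mono_support p fun x _ => h x

lemma expect_pure (x : α) (f : α → ℝ) : expect (PMF.pure x) f = f x := by
  classical
  rw [expect, Fintype.sum_eq_single x]
  · simp
  · intro y hy
    simp [PMF.pure_apply, hy]

lemma expect_bind (p : PMF α) (k : α → PMF β) (f : β → ℝ) :
    expect (p.bind k) f = expect p fun x => expect (k x) f := by
  have h : ∀ y, (p.bind k y).toReal = ∑ x, (p x).toReal * (k x y).toReal := by
    intro y
    rw [PMF.bind_apply, tsum_fintype, ENNReal.toReal_sum]
    · simp [ENNReal.toReal_mul]
    · exact fun x _ => ENNReal.mul_ne_top (p.apply_ne_top x) ((k x).apply_ne_top y)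
  simp only [expect, h, Finset.sum_mul, Finset.mul_sum]
  rw [Finset.sum_comm]
  exact Finset.sum_congr rfl fun x _ => Finset.sum_congr rfl fun y _ => by ring

lemma expect_map (p : PMF α) (F : α → β) (f : β → ℝ) :
    expect (p.map F) f = expect p fun x => f (F x) := by
  rw [← PMF.bind_pure_comp, expect_bind]
  simp [expect_pure]

lemma abs_expect_le (p : PMF α) {f : α → ℝ} {K : ℝ} (h : ∀ x, |f x| ≤ K) : |expect p f| ≤ K := by
  rw [abs_le]
  constructor
  · rw [← expect_const p (-K)]
    exact expect_mono p fun x => (abs_le.1 (h x)).1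
  · rw [← expect_const p K]
    exact expect_mono p fun x => (abs_le.1 (h x)).2

lemma exists_abs_le (f : α → ℝ) : ∃ K, ∀ x, |f x| ≤ K :=
  ⟨∑ x, |f x|, fun x =>
    Finset.single_le_sum (f := fun x => |f x|) (fun _ _ => abs_nonneg _) (Finset.mem_univ x)⟩

end Expectation

/-! ### Discounted sums versus averages -/

section Sequences

/-- If `e` is bounded and solves a discounted recursive inequality whose costs have linearly bounded
partial sums, then the normalized value at `0` is controlled by the slope. -/
lemma discounted_le_of_partial_sums_le {e c : ℕ → ℝ} {b J K C : ℝ} (hb0 : 0 ≤ b) (hb1 : b < 1)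
    (he : ∀ t, e t ≤ c t + b * e (t + 1)) (hC : ∀ t, |e t| ≤ C)
    (hK : ∀ T : ℕ, ∑ t ∈ Finset.range T, c t ≤ K + T * J) :
    (1 - b) * e 0 ≤ (1 - b) * K + J := by
  have hb : 0 < 1 - b := by linarith
  -- `m` is the discounted value of the constant cost `J`.
  set m := J / (1 - b) with hm
  have hmJ : (1 - b) * m = J := by rw [hm]; field_simp
  -- Summation by parts: at each step a mass `b ^ T * (1 - b)` of the excess of the partial sum over
  -- `(T + 1) * J` is replaced by its bound `K`.
  have key : ∀ T : ℕ, e 0 - m ≤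
      b ^ T * ((e T - m) + (∑ t ∈ Finset.range T, c t - T * J)) + (1 - b ^ T) * K := by
    intro T
    induction T with
    | zero => simp
    | succ T ih =>
      refine ih.trans ?_
      have hp : 0 ≤ b ^ T := pow_nonneg hb0 T
      have h1 : e T - m ≤ (c T - J) + b * (e (T + 1) - m) := by nlinarith [he T]
      have h2 := hK (T + 1)
      rw [Finset.sum_range_succ] at h2 ⊢
      push_cast at h2 ⊢
      set S := ∑ t ∈ Finset.range T, c t
      have h3 := mul_le_mul_of_nonneg_left h1 hp
      have h4 : b ^ T * (1 - b) * (S + c T - (T + 1) * J) ≤ b ^ T * (1 - b) * K :=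
        mul_le_mul_of_nonneg_left (by linarith) (mul_nonneg hp hb.le)
      rw [pow_succ]
      nlinarith
  have hlim : Tendsto (fun T : ℕ => b ^ T * (C + |m| + K) + (1 - b ^ T) * K) atTop
      (𝓝 (0 * (C + |m| + K) + (1 - 0) * K)) := by
    have h0 := tendsto_pow_atTop_nhds_zero_of_lt_one hb0 hb1
    exact (h0.mul_const _).add ((tendsto_const_nhds.sub h0).mul_const _)
  have h5 : e 0 - m ≤ 0 * (C + |m| + K) + (1 - 0) * K := by
    refine ge_of_tendsto' hlim fun T => (key T).trans ?_
    have hp : 0 ≤ b ^ T := pow_nonneg hb0 T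
    have h6 : (e T - m) + (∑ t ∈ Finset.range T, c t - T * J) ≤ C + |m| + K := by
      linarith [hK T, le_abs_self (e T), hC T, neg_abs_le m]
    linarith [mul_le_mul_of_nonneg_left h6 hp]
  nlinarith

/-- A sequence whose averages have a limsup below `J` lies below an affine function of slope `J`. -/
lemma exists_affine_bound_of_limsup_lt {S : ℕ → ℝ} {G J : ℝ} (hG : ∀ T : ℕ, |S T| ≤ T * G)
    (hJ : limsup (fun T : ℕ => 1 / (T : ℝ) * S T) atTop < J) :
    ∃ K, ∀ T : ℕ, S T ≤ K + T * J := by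
  -- A real `limsup` carries information only for bounded sequences.
  have hbd : IsBoundedUnder (· ≤ ·) atTop (fun T : ℕ => 1 / (T : ℝ) * S T) := by
    refine isBoundedUnder_of_eventually_le (a := G) ?_
    filter_upwards [eventually_gt_atTop 0] with T hT
    have hT' : (0 : ℝ) < T := by exact_mod_cast hT
    rw [one_div, inv_mul_le_iff₀ hT']
    exact (le_abs_self _).trans (hG T)
  obtain ⟨T₀, hT₀⟩ := eventually_atTop.1 (eventually_lt_of_limsup_lt hJ hbd)
  -- The range contains `T = 0`, where `1 / T` has the default value 0 and the average says nothing.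
  have hsum : ∀ T ∈ Finset.range (T₀ + 1),
      |S T - T * J| ≤ ∑ U ∈ Finset.range (T₀ + 1), |S U - U * J| :=
    fun T hT => Finset.single_le_sum (f := fun U : ℕ => |S U - U * J|)
      (fun _ _ => abs_nonneg _) hT
  refine ⟨∑ U ∈ Finset.range (T₀ + 1), |S U - U * J|, fun T => ?_⟩
  by_cases hT : T < T₀ + 1
  · linarith [hsum T (Finset.mem_range.2 hT), le_abs_self (S T - T * J)]
  · have hpos : (0 : ℝ) < T := by exact_mod_cast (by omega : 0 < T)
    have h1 := hT₀ T (by omega)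
    rw [one_div, inv_mul_lt_iff₀ hpos] at h1
    have h2 : 0 ≤ ∑ U ∈ Finset.range (T₀ + 1), |S U - U * J| :=
      Finset.sum_nonneg fun _ _ => abs_nonneg _
    linarith

end Sequences

/-! ### Harmonic functions and coboundaries of a finite chain -/

section ErgodicDecomposition

variable {α : Type*} [Fintype α]

/-- The operator on functions induced by a Markov kernel. -/
noncomputable def kernelOperator (k : α → PMF α) : (α → ℝ) →ₗ[ℝ] (α → ℝ) where
  toFun f x := expect (k x) f
  map_add' f g := by ext x; exact expect_add _ _ _
  map_smul' c f := by ext x; exact expect_const_mul _ _ _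

lemma abs_iterate_kernelOperator_le (k : α → PMF α) {f : α → ℝ} {K : ℝ} (h : ∀ x, |f x| ≤ K)
    (n : ℕ) (x : α) : |(kernelOperator k)^[n] f x| ≤ K := by
  induction n generalizing x with
  | zero => exact h x
  | succ n ih =>
    rw [Function.iterate_succ_apply']
    exact abs_expect_le _ ih

/-- Every function on a finite Markov chain is the sum of a harmonic function and a coboundary. -/
lemma exists_harmonic_add_coboundary (k : α → PMF α) (g : α → ℝ) :
    ∃ h f : α → ℝ, (∀ x, expect (k x) h = h x) ∧ ∀ x, g x = h x + f x - expect (k x) f := by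
  set Φ : (α → ℝ) →ₗ[ℝ] (α → ℝ) := LinearMap.id - kernelOperator k with hΦ
  have hdisj : Disjoint (LinearMap.ker Φ) (LinearMap.range Φ) := by
    rw [Submodule.disjoint_def]
    rintro y hy ⟨f, hf⟩
    have hLy : kernelOperator k y = y := by
      have : y - kernelOperator k y = 0 := hy
      exact (sub_eq_zero.1 this).symm
    have hLf : kernelOperator k f = f - y := by
      rw [← hf]; simp [hΦ]
    -- A nonzero harmonic coboundary would make these iterates unbounded, but the kernel does not
    -- increase the sup norm. Rank-nullity then turns disjointness into a direct sum.
    have hit : ∀ n : ℕ, (kernelOperator k)^[n] f = f - (n : ℝ) • y := by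
      intro n
      induction n with
      | zero => simp
      | succ n ih =>
        rw [Function.iterate_succ_apply', ih, map_sub, map_smul, hLy, hLf]
        push_cast
        module
    obtain ⟨K, hK⟩ := exists_abs_le f
    ext x
    by_contra hne
    have hpos : 0 < |y x| := abs_pos.2 hne
    obtain ⟨n, hn⟩ := exists_nat_gt (2 * K / |y x|)
    rw [div_lt_iff₀ hpos] at hn
    have h1 := abs_iterate_kernelOperator_le k hK n x
    rw [hit n] at h1
    have h2 : |(n : ℝ) * y x| = n * |y x| := by rw [abs_mul, Nat.abs_cast]
    have h3 : |(n : ℝ) * y x| ≤ |f x| + |f x - n * y x| := by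
      have := abs_sub (f x) (f x - n * y x)
      simpa using this
    simp only [Pi.sub_apply, Pi.smul_apply, smul_eq_mul] at h1
    linarith [hK x]
  have htop : LinearMap.ker Φ ⊔ LinearMap.range Φ = ⊤ := by
    apply Submodule.eq_top_of_disjoint _ _ _ hdisj
    rw [add_comm]
    exact (LinearMap.finrank_range_add_finrank_ker Φ).ge
  have hg : g ∈ LinearMap.ker Φ ⊔ LinearMap.range Φ := htop ▸ Submodule.mem_top
  obtain ⟨h, hh, z, ⟨f, rfl⟩, hsum⟩ := Submodule.mem_sup.1 hg
  refine ⟨h, f, fun x => ?_, fun x => ?_⟩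
  · have : h x - expect (k x) h = 0 := congrFun hh x
    linarith
  · rw [← hsum]
    change h x + (f x - expect (k x) f) = _
    ring

end ErgodicDecomposition

/-! ### The driving noise -/

namespace Model

variable {N B E : ℕ} {S D : Type*} (M : Model N B E S D)

/-- Joint law of the next grid state, the next demand state and the new connections. -/
noncomputable def noise (l : Fin N → ℕ) (A : ℕ) (s : S) (d : D) :
    PMF (S × D × (Fin N → Option (Request B E))) :=
  (M.grid A s).bind fun s' => (M.demand d).bind fun db =>
    (M.connect l db.2).map fun c => (s', db.1, c)

/-- The noise depends on the state and the action only through stays, total, grid and demand, so two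
state-action pairs agreeing in these can be coupled. -/
lemma step_eq_map_noise (x : SystemState N B E S D) (a : Action N) :
    M.step x a = (M.noise (fun i => (x.1 i).stay) a.total x.2.1 x.2.2).map
      fun w => (fun i => (x.1 i).next (a i) (w.2.2 i), w.1, w.2.1) := by
  simp only [step, noise, PMF.map_bind, PMF.map_comp]
  rfl

lemma stay_le_one_of_mem_support_noise {l : Fin N → ℕ} {A : ℕ} {s : S} {d : D}
    {w : S × D × (Fin N → Option (Request B E))} (hw : w ∈ (M.noise l A s d).support)
    (i : Fin N) (hi : w.2.2 i ≠ none) : l i ≤ 1 := by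
  simp only [noise, PMF.mem_support_bind_iff, PMF.mem_support_map_iff] at hw
  obtain ⟨s', -, db, -, c, hc, rfl⟩ := hw
  exact M.connect_free l db.2 c hc i hi

/-- Increment of the penalty. -/
def increment (n : ℕ) : ℝ := M.penalty (n + 1) - M.penalty n

variable {M} in
lemma ConvexPenalty.monotone_increment (h : M.ConvexPenalty) : Monotone M.increment :=
  monotone_nat_of_le_succ fun n => (h n).2

/-- Penalty paid at charger `i`. -/
def exitPenalty (x : SystemState N B E S D) (a : Action N) (i : Fin N) : ℝ :=
  if (x.1 i).stay = 1 then M.penalty ((x.1 i).need - (a i : ℕ)) else 0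

lemma stageCost_eq (x : SystemState N B E S D) (a : Action N) :
    M.stageCost x a = M.chargingCost a.total x.2.1 + ∑ i, M.exitPenalty x a i := by
  simp only [stageCost, exitPenalty, Finset.sum_filter]

end Model

/-! ### Evolution of one charger -/

lemma ChargerState.ext_stay_need {B E : ℕ} {v w : ChargerState B E} (h₁ : v.stay = w.stay)
    (h₂ : v.need = w.need) : v = w :=
  Subtype.ext (Prod.ext (Fin.ext h₁) (Fin.ext h₂))

lemma ChargerState.stay_evolve {B E : ℕ} {v : ChargerState B E} (h : 2 ≤ v.stay) (a : Fin 2) :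
    (v.evolve a).stay = v.stay - 1 := by
  rw [evolve, dif_pos h]; rfl

lemma ChargerState.need_evolve {B E : ℕ} {v : ChargerState B E} (h : 2 ≤ v.stay) (a : Fin 2) :
    (v.evolve a).need = v.need - (a : ℕ) := by
  rw [evolve, dif_pos h]; rfl

/-- Two vehicles with the same stay and the same remaining need after the action evolve alike. -/
lemma ChargerState.evolve_congr {B E : ℕ} {v w : ChargerState B E} {a b : Fin 2}
    (h₁ : v.stay = w.stay) (h₂ : v.need - (a : ℕ) = w.need - (b : ℕ)) :
    v.evolve a = w.evolve b := by
  by_cases h : 2 ≤ v.stay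
  · have h' : 2 ≤ w.stay := h₁ ▸ h
    apply ChargerState.ext_stay_need
    · rw [stay_evolve h, stay_evolve h', h₁]
    · rw [need_evolve h, need_evolve h', h₂]
  · rw [evolve, evolve, dif_neg h, dif_neg (h₁ ▸ h)]

lemma ChargerState.next_congr {B E : ℕ} {v w : ChargerState B E} {a b : Fin 2}
    {o : Option (Request B E)} (h₁ : v.stay = w.stay)
    (h₂ : v.need - (a : ℕ) = w.need - (b : ℕ)) : v.next a o = w.next b o := by
  cases o with
  | none => exact evolve_congr h₁ h₂
  | some r => rfl

/-- Vehicles in their last stage are forgotten. -/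
lemma ChargerState.next_congr_of_stay_le_one {B E : ℕ} {v w : ChargerState B E} {a b : Fin 2}
    {o : Option (Request B E)} (h₁ : v.stay = w.stay) (h₂ : v.stay ≤ 1) :
    v.next a o = w.next b o := by
  cases o with
  | none =>
    change v.evolve a = w.evolve b
    rw [evolve, evolve, dif_neg (by omega), dif_neg (by omega)]
  | some r => rfl

/-! ### Shift inequalities -/

/-- `Shift M x' x c`: the elementary modifications of the needs for which the cost-to-go of `x'`
plus `c` is at most that of `x`. -/
inductive Shift {N B E : ℕ} {S D : Type*} (M : Model N B E S D) :
    SystemState N B E S D → SystemState N B E S D → ℝ → Prop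
  | raise {x' x : SystemState N B E S D} (i : Fin N) (hx : x'.2 = x.2)
      (hne : ∀ k, k ≠ i → x'.1 k = x.1 k) (hstay : (x'.1 i).stay = (x.1 i).stay)
      (hneed : (x'.1 i).need = (x.1 i).need + 1) :
      Shift M x' x (-M.increment (x.1 i).need)
  -- By `hn`, vehicle `j` leaves with at least `n + 1` units missing even if always charged, so the
  -- removed unit saves at least the increment at `n`.
  | lower {x' x : SystemState N B E S D} (j : Fin N) (n : ℕ) (hx : x'.2 = x.2)
      (hne : ∀ k, k ≠ j → x'.1 k = x.1 k) (hstay : (x'.1 j).stay = (x.1 j).stay)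
      (hpos : 0 < (x.1 j).stay)
      (hneed : (x.1 j).need = (x'.1 j).need + 1) (hn : (x.1 j).stay + n + 1 ≤ (x.1 j).need) :
      Shift M x' x (M.increment n)
  -- Think of needs `(x.1 i).need + 1` and `(x.1 j).need` where `j` has weak priority over `i`:
  -- charging `i` leads to `x`, charging `j` to `x'`.
  | swap {x' x : SystemState N B E S D} (i j : Fin N) (hij : i ≠ j) (hx : x'.2 = x.2)
      (hne : ∀ k, k ≠ i → k ≠ j → x'.1 k = x.1 k)
      (hstayi : (x'.1 i).stay = (x.1 i).stay) (hstayj : (x'.1 j).stay = (x.1 j).stay)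
      (hi : 0 < (x.1 i).stay) (hj : 0 < (x.1 j).stay)
      (hneedi : (x'.1 i).need = (x.1 i).need + 1) (hneedj : (x.1 j).need = (x'.1 j).need + 1)
      (hneed : (x.1 i).need + 1 ≤ (x.1 j).need)
      (hlax : (x.1 j).stay + (x.1 i).need + 1 ≤ (x.1 i).stay + (x.1 j).need) :
      Shift M x' x 0

/-- Functions of the state that respect all shifts. -/
def shiftMonotone {N B E : ℕ} {S D : Type*} (M : Model N B E S D) :
    Set (SystemState N B E S D → ℝ) :=
  {V | ∀ x' x c, Shift M x' x c → V x' + c ≤ V x}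

lemma isClosed_shiftMonotone {N B E : ℕ} {S D : Type*} (M : Model N B E S D) :
    IsClosed (shiftMonotone M) := by
  simp only [shiftMonotone, Set.ofPred_forall]
  refine isClosed_iInter fun x' => isClosed_iInter fun x => isClosed_iInter fun c =>
    isClosed_iInter fun _ => ?_
  exact isClosed_le ((continuous_apply x').add continuous_const) (continuous_apply x)

lemma shiftMonotone_convex_comb {N B E : ℕ} {S D : Type*} {M : Model N B E S D}
    {V W : SystemState N B E S D → ℝ} (hV : V ∈ shiftMonotone M) (hW : W ∈ shiftMonotone M)
    {b : ℝ} (hb0 : 0 ≤ b) (hb1 : b ≤ 1) :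
    (fun x => b * V x + (1 - b) * W x) ∈ shiftMonotone M := by
  intro x' x c h
  have h1 := mul_le_mul_of_nonneg_left (hV x' x c h) hb0
  have h2 := mul_le_mul_of_nonneg_left (hW x' x c h) (sub_nonneg.2 hb1)
  dsimp only
  linarith

/-- Total penalty for the current needs. -/
def Model.potential {N B E : ℕ} {S D : Type*} (M : Model N B E S D)
    (x : SystemState N B E S D) : ℝ := ∑ i, M.penalty (x.1 i).need

lemma sum_sub_sum_eq_of_eq_off {N : ℕ} {f g : Fin N → ℝ} (i : Fin N)
    (h : ∀ k, k ≠ i → f k = g k) : ∑ k, f k - ∑ k, g k = f i - g i := by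
  rw [← Finset.sum_sub_distrib]
  exact Fintype.sum_eq_single i fun k hk => sub_eq_zero.2 (h k hk)

lemma sum_sub_sum_eq_of_eq_off_pair {N : ℕ} {f g : Fin N → ℝ} {i j : Fin N} (hij : i ≠ j)
    (h : ∀ k, k ≠ i → k ≠ j → f k = g k) :
    ∑ k, f k - ∑ k, g k = (f i - g i) + (f j - g j) := by
  rw [← Finset.sum_sub_distrib]
  exact Fintype.sum_eq_add i j hij fun k hk => sub_eq_zero.2 (h k hk.1 hk.2)

/-- `raise` is an equality; `lower` and `swap` compare two increments of a convex penalty. -/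
lemma potential_mem_shiftMonotone {N B E : ℕ} {S D : Type*} {M : Model N B E S D}
    (hM : M.ConvexPenalty) : M.potential ∈ shiftMonotone M := by
  intro x' x c h
  unfold Model.potential
  cases h with
  | raise i hx hne hstay hneed =>
    have := sum_sub_sum_eq_of_eq_off (f := fun k => M.penalty (x'.1 k).need)
      (g := fun k => M.penalty (x.1 k).need) i fun k hk => by rw [hne k hk]
    rw [hneed] at this
    unfold Model.increment
    linarith
  | lower j n hx hne hstay hpos hneed hn =>
    have := sum_sub_sum_eq_of_eq_off (f := fun k => M.penalty (x'.1 k).need)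
      (g := fun k => M.penalty (x.1 k).need) j fun k hk => by rw [hne k hk]
    have hmono := hM.monotone_increment (show n ≤ (x'.1 j).need by omega)
    rw [hneed] at this
    unfold Model.increment at *
    linarith
  | swap i j hij hx hne hstayi hstayj hi hj hneedi hneedj hneed hlax =>
    have := sum_sub_sum_eq_of_eq_off_pair (f := fun k => M.penalty (x'.1 k).need)
      (g := fun k => M.penalty (x.1 k).need) hij fun k hk hk' => by rw [hne k hk hk']
    have hmono := hM.monotone_increment (show (x.1 i).need ≤ (x'.1 j).need by omega)
    rw [hneedi, hneedj] at this
    unfold Model.increment at *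
    linarith

/-! ### Propagation of shifts through one stage -/

section ActionValue

variable {N B E : ℕ} {S D : Type*} [Fintype S] [Fintype D] (M : Model N B E S D)

/-- Cost of the action `a` at `x` when the cost-to-go is `V`. -/
noncomputable def Model.actionValue (V : SystemState N B E S D → ℝ) (x : SystemState N B E S D)
    (a : Action N) : ℝ :=
  M.stageCost x a + expect (M.step x a) V

variable {M}

/-- Pathwise comparison of two state-action pairs with the same driving noise. -/
lemma actionValue_add_le {V : SystemState N B E S D → ℝ} {x' x : SystemState N B E S D}
    {a' a : Action N} {c : ℝ} (hx : x'.2 = x.2) (hstay : ∀ k, (x'.1 k).stay = (x.1 k).stay)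
    (htotal : a'.total = a.total)
    (h : ∀ s d, ∀ o : Fin N → Option (Request B E), (∀ k, o k ≠ none → (x.1 k).stay ≤ 1) →
      (∑ k, M.exitPenalty x' a' k - ∑ k, M.exitPenalty x a k) +
        V (fun k => (x'.1 k).next (a' k) (o k), s, d) + c ≤
          V (fun k => (x.1 k).next (a k) (o k), s, d)) :
    M.actionValue V x' a' + c ≤ M.actionValue V x a := by
  classical
  simp only [Model.actionValue, Model.stageCost_eq, Model.step_eq_map_noise, expect_map, hx, hstay,
    htotal]
  set p := M.noise (fun i => (x.1 i).stay) a.total x.2.1 x.2.2 with hp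
  -- Only noise in the support matters: there no vehicle with at least two stages left is replaced.
  have := expect_mono_support p (f := fun w =>
    V (fun k => (x'.1 k).next (a' k) (w.2.2 k), w.1, w.2.1) +
      ((∑ k, M.exitPenalty x' a' k - ∑ k, M.exitPenalty x a k) + c))
    (g := fun w => V (fun k => (x.1 k).next (a k) (w.2.2 k), w.1, w.2.1)) (by
      intro w hw
      have := h w.1 w.2.1 w.2.2 fun k hk => M.stay_le_one_of_mem_support_noise hw k hk
      linarith)
  rw [expect_add, expect_const] at this
  linarith

/-- Charging a vehicle less by one unit. -/
lemma actionValue_raise (hM : M.ConvexPenalty) {V : SystemState N B E S D → ℝ}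
    (hV : V ∈ shiftMonotone M) {x' x : SystemState N B E S D} {a : Action N} (i : Fin N)
    (hx : x'.2 = x.2) (hne : ∀ k, k ≠ i → x'.1 k = x.1 k)
    (hstay : (x'.1 i).stay = (x.1 i).stay) (hneed : (x'.1 i).need = (x.1 i).need + 1)
    (ha : (a i : ℕ) ≤ (x.1 i).need) :
    M.actionValue V x' a + -M.increment (x.1 i).need ≤ M.actionValue V x a := by
  have hst : ∀ k, (x'.1 k).stay = (x.1 k).stay := fun k => by
    by_cases hk : k = i
    · rw [hk, hstay]
    · rw [hne k hk]
  have hmono := hM.monotone_increment (show (x.1 i).need - (a i : ℕ) ≤ (x.1 i).need by omega)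
  have hnonneg := (hM (x.1 i).need).1
  refine actionValue_add_le hx hst rfl fun s d o ho => ?_
  rw [sum_sub_sum_eq_of_eq_off i fun k hk => by simp only [Model.exitPenalty, hne k hk]]
  have hsub : (x'.1 i).need - (a i : ℕ) = (x.1 i).need - (a i : ℕ) + 1 := by omega
  by_cases h2 : 2 ≤ (x.1 i).stay
  · have hoi : o i = none := by
      by_contra hcon
      have := ho i hcon
      omega
    have hsh := hV _ _ _ (Shift.raise (M := M)
      (x' := (fun k => (x'.1 k).next (a k) (o k), s, d))
      (x := (fun k => (x.1 k).next (a k) (o k), s, d)) i rfl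
      (fun k hk => by simp only [hne k hk])
      (by simp only [hoi, ChargerState.next]
          rw [ChargerState.stay_evolve h2, ChargerState.stay_evolve (hstay ▸ h2), hstay])
      (by simp only [hoi, ChargerState.next]
          rw [ChargerState.need_evolve h2, ChargerState.need_evolve (hstay ▸ h2), hsub]))
    have hnext : ((x.1 i).next (a i) (o i)).need = (x.1 i).need - (a i : ℕ) := by
      rw [hoi]; exact ChargerState.need_evolve h2 _
    rw [hnext] at hsh
    simp only [Model.exitPenalty, hstay, if_neg (show (x.1 i).stay ≠ 1 by omega)]
    linarith
  · have hstate : (fun k => (x'.1 k).next (a k) (o k)) = fun k => (x.1 k).next (a k) (o k) := by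
      funext k
      by_cases hk : k = i
      · subst hk
        exact ChargerState.next_congr_of_stay_le_one hstay (by omega)
      · rw [hne k hk]
    rw [hstate]
    simp only [Model.exitPenalty, hstay, hsub]
    unfold Model.increment at *
    split_ifs <;> linarith

/-- Lowering the need of a vehicle that cannot be completed. -/
lemma actionValue_lower (hM : M.ConvexPenalty) {V : SystemState N B E S D → ℝ}
    (hV : V ∈ shiftMonotone M) {x' x : SystemState N B E S D} {a : Action N} (j : Fin N) (n : ℕ)
    (hx : x'.2 = x.2) (hne : ∀ k, k ≠ j → x'.1 k = x.1 k)
    (hstay : (x'.1 j).stay = (x.1 j).stay) (hpos : 0 < (x.1 j).stay)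
    (hneed : (x.1 j).need = (x'.1 j).need + 1) (hn : (x.1 j).stay + n + 1 ≤ (x.1 j).need) :
    M.actionValue V x' a + M.increment n ≤ M.actionValue V x a := by
  have hst : ∀ k, (x'.1 k).stay = (x.1 k).stay := fun k => by
    by_cases hk : k = j
    · rw [hk, hstay]
    · rw [hne k hk]
  have haj : (a j : ℕ) ≤ 1 := by omega
  have hmono := hM.monotone_increment (show n ≤ (x'.1 j).need - (a j : ℕ) by omega)
  refine actionValue_add_le hx hst rfl fun s d o ho => ?_
  rw [sum_sub_sum_eq_of_eq_off j fun k hk => by simp only [Model.exitPenalty, hne k hk]]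
  have hsub : (x.1 j).need - (a j : ℕ) = (x'.1 j).need - (a j : ℕ) + 1 := by omega
  by_cases h2 : 2 ≤ (x.1 j).stay
  · have hoi : o j = none := by
      by_contra hcon
      have := ho j hcon
      omega
    have hsh := hV _ _ _ (Shift.lower (M := M)
      (x' := (fun k => (x'.1 k).next (a k) (o k), s, d))
      (x := (fun k => (x.1 k).next (a k) (o k), s, d)) j n rfl
      (fun k hk => by simp only [hne k hk])
      (by simp only [hoi, ChargerState.next]
          rw [ChargerState.stay_evolve h2, ChargerState.stay_evolve (hstay ▸ h2), hstay])
      (by simp only [hoi, ChargerState.next]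
          rw [ChargerState.stay_evolve h2]; omega)
      (by simp only [hoi, ChargerState.next]
          rw [ChargerState.need_evolve h2, ChargerState.need_evolve (hstay ▸ h2), hsub])
      (by simp only [hoi, ChargerState.next]
          rw [ChargerState.need_evolve h2, ChargerState.stay_evolve h2]; omega))
    simp only [Model.exitPenalty, hstay, if_neg (show (x.1 j).stay ≠ 1 by omega)]
    linarith
  · have hstate : (fun k => (x'.1 k).next (a k) (o k)) = fun k => (x.1 k).next (a k) (o k) := by
      funext k
      by_cases hk : k = j
      · subst hk
        exact ChargerState.next_congr_of_stay_le_one hstay (by omega)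
      · rw [hne k hk]
    rw [hstate]
    simp only [Model.exitPenalty, hstay, hsub, if_pos (show (x.1 j).stay = 1 by omega)]
    unfold Model.increment at *
    linarith

/-- Interchange: it is no worse to be left after the action with one more unit of vehicle `i` and
one less of vehicle `j`, if `j` has less laxity and longer remaining need. -/
lemma actionValue_swap (hM : M.ConvexPenalty) {V : SystemState N B E S D → ℝ}
    (hV : V ∈ shiftMonotone M) {x' x : SystemState N B E S D} {a' a : Action N} {i j : Fin N}
    (hij : i ≠ j) (hx : x'.2 = x.2) (hstay : ∀ k, (x'.1 k).stay = (x.1 k).stay)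
    (htotal : a'.total = a.total)
    (hne : ∀ k, k ≠ i → k ≠ j → (x'.1 k).need - (a' k : ℕ) = (x.1 k).need - (a k : ℕ))
    (hi : 0 < (x.1 i).stay) (hj : 0 < (x.1 j).stay) {p r : ℕ}
    (hpi : (x.1 i).need - (a i : ℕ) = p) (hpi' : (x'.1 i).need - (a' i : ℕ) = p + 1)
    (hrj : (x.1 j).need - (a j : ℕ) = r + 1) (hrj' : (x'.1 j).need - (a' j : ℕ) = r)
    (hpr : p ≤ r) (hlax : (x.1 j).stay + p ≤ (x.1 i).stay + r) :
    M.actionValue V x' a' ≤ M.actionValue V x a := by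
  have hmono := hM.monotone_increment hpr
  have main := actionValue_add_le (M := M) (V := V) (a' := a') (a := a) (c := 0) hx hstay htotal
    fun s d o ho => ?_
  · simpa using main
  rw [sum_sub_sum_eq_of_eq_off_pair hij fun k hk hk' => by
    simp only [Model.exitPenalty, hstay, hne k hk hk']]
  have hoff : ∀ k, k ≠ i → k ≠ j → (x'.1 k).next (a' k) (o k) = (x.1 k).next (a k) (o k) :=
    fun k hk hk' => ChargerState.next_congr (hstay k) (hne k hk hk')
  have hnone : ∀ k, 2 ≤ (x.1 k).stay → o k = none := by
    intro k hk
    by_contra hcon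
    have := ho k hcon
    omega
  have hlast : ∀ k, (x.1 k).stay ≤ 1 → (x'.1 k).next (a' k) (o k) = (x.1 k).next (a k) (o k) :=
    fun k hk => ChargerState.next_congr_of_stay_le_one (hstay k) (by rw [hstay k]; exact hk)
  have hs : ∀ k, 2 ≤ (x.1 k).stay → ((x.1 k).next (a k) (o k)).stay = (x.1 k).stay - 1 := by
    intro k hk
    rw [hnone k hk]
    exact ChargerState.stay_evolve hk _
  have hs' : ∀ k, 2 ≤ (x.1 k).stay → ((x'.1 k).next (a' k) (o k)).stay = (x.1 k).stay - 1 := by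
    intro k hk
    rw [hnone k hk, ← hstay k]
    exact ChargerState.stay_evolve (by rw [hstay k]; exact hk) _
  have hn : ∀ k, 2 ≤ (x.1 k).stay →
      ((x.1 k).next (a k) (o k)).need = (x.1 k).need - (a k : ℕ) := by
    intro k hk
    rw [hnone k hk]
    exact ChargerState.need_evolve hk _
  have hn' : ∀ k, 2 ≤ (x.1 k).stay →
      ((x'.1 k).next (a' k) (o k)).need = (x'.1 k).need - (a' k : ℕ) := by
    intro k hk
    rw [hnone k hk]
    exact ChargerState.need_evolve (by rw [hstay k]; exact hk) _
  simp only [Model.exitPenalty, hstay, hpi, hpi', hrj, hrj']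
  unfold Model.increment at hmono
  -- If both stay, the swap persists. If only `j` leaves, its saving, the increment at `r`, pays for
  -- raising `i`. If only `i` leaves, its loss, the increment at `p`, is recovered by lowering `j`,
  -- which `hlax` shows cannot be completed below `p + 1`. If both leave, convexity suffices.
  by_cases h2i : 2 ≤ (x.1 i).stay <;> by_cases h2j : 2 ≤ (x.1 j).stay
  · have hsh := hV _ _ _ (Shift.swap (M := M)
      (x' := (fun k => (x'.1 k).next (a' k) (o k), s, d))
      (x := (fun k => (x.1 k).next (a k) (o k), s, d)) i j hij rfl hoff
      (by rw [hs i h2i, hs' i h2i]) (by rw [hs j h2j, hs' j h2j])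
      (by rw [hs i h2i]; omega) (by rw [hs j h2j]; omega)
      (by rw [hn i h2i, hn' i h2i]; omega) (by rw [hn j h2j, hn' j h2j]; omega)
      (by rw [hn i h2i, hn j h2j]; omega)
      (by rw [hn i h2i, hn j h2j, hs i h2i, hs j h2j]; omega))
    rw [if_neg (by omega), if_neg (by omega), if_neg (by omega), if_neg (by omega)]
    linarith
  · have hsh := hV _ _ _ (Shift.raise (M := M)
      (x' := (fun k => (x'.1 k).next (a' k) (o k), s, d))
      (x := (fun k => (x.1 k).next (a k) (o k), s, d)) i rfl
      (fun k hk => by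
        by_cases hkj : k = j
        · subst hkj; exact hlast k (by omega)
        · exact hoff k hk hkj)
      (by rw [hs i h2i, hs' i h2i]) (by rw [hn i h2i, hn' i h2i]; omega))
    rw [hn i h2i, hpi] at hsh
    unfold Model.increment at hsh
    rw [if_neg (by omega), if_neg (by omega), if_pos (by omega), if_pos (by omega)]
    linarith
  · have hsh := hV _ _ _ (Shift.lower (M := M)
      (x' := (fun k => (x'.1 k).next (a' k) (o k), s, d))
      (x := (fun k => (x.1 k).next (a k) (o k), s, d)) j p rfl
      (fun k hk => by
        by_cases hki : k = i
        · subst hki; exact hlast k (by omega)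
        · exact hoff k hki hk)
      (by rw [hs j h2j, hs' j h2j]) (by rw [hs j h2j]; omega)
      (by rw [hn j h2j, hn' j h2j]; omega) (by rw [hn j h2j, hs j h2j]; omega))
    unfold Model.increment at hsh
    rw [if_pos (by omega), if_pos (by omega), if_neg (by omega), if_neg (by omega)]
    linarith
  · have hstate : (fun k => (x'.1 k).next (a' k) (o k)) = fun k => (x.1 k).next (a k) (o k) := by
      funext k
      by_cases hk : k = i
      · subst hk; exact hlast k (by omega)
      by_cases hk' : k = j
      · subst hk'; exact hlast k (by omega)
      exact hoff k hk hk'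
    rw [hstate, if_pos (by omega), if_pos (by omega), if_pos (by omega), if_pos (by omega)]
    linarith

/-- Exchanging the actions of two vehicles. -/
lemma total_comp_swap (a : Action N) (i j : Fin N) :
    Action.total (fun k => a (Equiv.swap i j k)) = a.total :=
  Equiv.sum_comp (Equiv.swap i j) fun k => (a k : ℕ)

/-- Every action at `x` is matched by an action at the shifted state. -/
lemma exists_actionValue_add_le_of_shift (hM : M.ConvexPenalty) {V : SystemState N B E S D → ℝ}
    (hV : V ∈ shiftMonotone M) {x' x : SystemState N B E S D} {c : ℝ} (h : Shift M x' x c)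
    {a : Action N} (ha : Feasible x a) :
    ∃ a', Feasible x' a' ∧ M.actionValue V x' a' + c ≤ M.actionValue V x a := by
  cases h with
  | raise i hx hne hstay hneed =>
    refine ⟨a, fun k => ?_, actionValue_raise hM hV i hx hne hstay hneed (ha i)⟩
    by_cases hk : k = i
    · subst hk
      have := ha k
      omega
    · rw [hne k hk]; exact ha k
  | lower j n hx hne hstay hpos hneed hn =>
    refine ⟨a, fun k => ?_, actionValue_lower hM hV j n hx hne hstay hpos hneed hn⟩
    by_cases hk : k = j
    · subst hk
      omega
    · rw [hne k hk]; exact ha k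
  | swap i j hij hx hne hstayi hstayj hi hj hneedi hneedj hneed hlax =>
    have hst : ∀ k, (x'.1 k).stay = (x.1 k).stay := fun k => by
      by_cases hk : k = i
      · rw [hk, hstayi]
      by_cases hk' : k = j
      · rw [hk', hstayj]
      rw [hne k hk hk']
    have hai := ha i
    have haj := ha j
    -- Only here can the order of the needs be lost after the action; charging `i` instead of `j` at
    -- `x'` then gives exactly the same post-action needs.
    by_cases hcase : (a i : ℕ) = 0 ∧ (a j : ℕ) = 1
    · refine ⟨fun k => a (Equiv.swap i j k), fun k => ?_, ?_⟩
      · dsimp only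
        by_cases hk : k = i
        · subst hk
          rw [Equiv.swap_apply_left]; omega
        by_cases hk' : k = j
        · subst hk'
          rw [Equiv.swap_apply_right]; omega
        rw [Equiv.swap_apply_of_ne_of_ne hk hk', hne k hk hk']
        exact ha k
      · have hpost : ∀ k, (x'.1 k).need - (a (Equiv.swap i j k) : ℕ) =
            (x.1 k).need - (a k : ℕ) := by
          intro k
          by_cases hk : k = i
          · subst hk
            rw [Equiv.swap_apply_left]; omega
          by_cases hk' : k = j
          · subst hk'
            rw [Equiv.swap_apply_right]; omega
          rw [Equiv.swap_apply_of_ne_of_ne hk hk', hne k hk hk']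
        refine actionValue_add_le hx hst (total_comp_swap a i j) fun s d o ho => ?_
        have hstate : (fun k => (x'.1 k).next (a (Equiv.swap i j k)) (o k)) =
            fun k => (x.1 k).next (a k) (o k) :=
          funext fun k => ChargerState.next_congr (hst k) (hpost k)
        simp only [Model.exitPenalty, hst, hpost, hstate]
        simp
    · refine ⟨a, fun k => ?_, ?_⟩
      · by_cases hk : k = i
        · subst hk; omega
        by_cases hk' : k = j
        · subst hk'; omega
        rw [hne k hk hk']; exact ha k
      · rw [add_zero]
        exact actionValue_swap hM hV hij hx hst rfl (fun k hk hk' => by rw [hne k hk hk']) hi hj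
          (p := (x.1 i).need - (a i : ℕ)) (r := (x'.1 j).need - (a j : ℕ)) rfl
          (by omega) (by omega) rfl (by omega) (by omega)

/-- Charging the vehicle of higher priority instead is no worse. -/
lemma actionValue_comp_swap_le (hM : M.ConvexPenalty) {V : SystemState N B E S D → ℝ}
    (hV : V ∈ shiftMonotone M) {x : SystemState N B E S D} {a : Action N} (ha : Feasible x a)
    {i j : Fin N} (hp : Priority x i j) (hi : (a i : ℕ) = 1) (hj : (a j : ℕ) = 0) :
    Feasible x (fun k => a (Equiv.swap i j k)) ∧
      M.actionValue V x (fun k => a (Equiv.swap i j k)) ≤ M.actionValue V x a := by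
  obtain ⟨hsi, hsj, hlax, hneed, -⟩ := hp
  have hai := ha i
  have hij : i ≠ j := by rintro rfl; omega
  -- Since `i` is charged, both needs are positive and neither laxity is the default `B`.
  simp only [ChargerState.laxity, if_pos (show 0 < (x.1 i).need by omega),
    if_pos (show 0 < (x.1 j).need by omega)] at hlax
  refine ⟨fun k => ?_, ?_⟩
  · dsimp only
    by_cases hk : k = i
    · subst hk
      rw [Equiv.swap_apply_left]; omega
    by_cases hk' : k = j
    · subst hk'
      rw [Equiv.swap_apply_right]; omega
    rw [Equiv.swap_apply_of_ne_of_ne hk hk']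
    exact ha k
  · refine actionValue_swap hM hV hij rfl (fun _ => rfl) (total_comp_swap a i j)
      (fun k hk hk' => by rw [Equiv.swap_apply_of_ne_of_ne hk hk']) hsi hsj
      (p := (x.1 i).need - 1) (r := (x.1 j).need - 1) (by rw [hi]) ?_ ?_ ?_ (by omega) (by omega)
    · rw [Equiv.swap_apply_left]; omega
    · omega
    · rw [Equiv.swap_apply_right]; omega

end ActionValue

/-! ### Feasible actions and the priority weight -/

section Actions

variable {N B E : ℕ} {S D : Type*}

open scoped Classical in
/-- The feasible actions at `x`. -/
noncomputable def feasibleActions (x : SystemState N B E S D) : Finset (Action N) :=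
  Finset.univ.filter (Feasible x)

lemma feasibleActions_nonempty (x : SystemState N B E S D) : (feasibleActions x).Nonempty :=
  ⟨fun _ => 0, by simp [feasibleActions, Feasible]⟩

/-- Weight of an action, increased by charging vehicles of higher priority. -/
def priorityWeight (x : SystemState N B E S D) (a : Action N) : ℤ :=
  ∑ k, ((a k : ℕ) : ℤ) * ((x.1 k).need - (x.1 k).laxity)

lemma priorityWeight_lt_comp_swap {x : SystemState N B E S D} {a : Action N} {i j : Fin N}
    (hp : Priority x i j) (hi : (a i : ℕ) = 1) (hj : (a j : ℕ) = 0) :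
    priorityWeight x a < priorityWeight x fun k => a (Equiv.swap i j k) := by
  have hij : i ≠ j := by rintro rfl; omega
  obtain ⟨-, -, hlax, hneed, hstrict⟩ := hp
  rw [← sub_pos]
  unfold priorityWeight
  rw [← Finset.sum_sub_distrib, Fintype.sum_eq_add i j hij]
  · dsimp only
    rw [Equiv.swap_apply_left, Equiv.swap_apply_right, hi, hj]
    push_cast
    omega
  · intro k hk
    dsimp only
    rw [Equiv.swap_apply_of_ne_of_ne hk.1 hk.2, sub_self]

end Actions

/-! ### Stopped problems and greedy policies -/

section Bellman

variable {N B E : ℕ} {S D : Type*} [Fintype S] [Fintype D] (M : Model N B E S D)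

/-- The undiscounted Bellman operator. -/
noncomputable def Model.bellman (V : SystemState N B E S D → ℝ) (x : SystemState N B E S D) : ℝ :=
  (feasibleActions x).inf' (feasibleActions_nonempty x) (M.actionValue V x)

variable {M}

lemma bellman_le {V : SystemState N B E S D → ℝ} {x : SystemState N B E S D} {a : Action N}
    (ha : Feasible x a) : M.bellman V x ≤ M.actionValue V x a :=
  Finset.inf'_le _ (by simpa [feasibleActions] using ha)

lemma exists_bellman_eq (V : SystemState N B E S D → ℝ) (x : SystemState N B E S D) :
    ∃ a, Feasible x a ∧ M.bellman V x = M.actionValue V x a := by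
  obtain ⟨a, ha, h⟩ := Finset.exists_mem_eq_inf' (feasibleActions_nonempty x) (M.actionValue V x)
  exact ⟨a, by simpa [feasibleActions] using ha, h⟩

lemma bellman_mem_shiftMonotone (hM : M.ConvexPenalty) {V : SystemState N B E S D → ℝ}
    (hV : V ∈ shiftMonotone M) : M.bellman V ∈ shiftMonotone M := by
  intro x' x c h
  obtain ⟨a, ha, hVa⟩ := exists_bellman_eq (M := M) V x
  obtain ⟨a', ha', hle⟩ := exists_actionValue_add_le_of_shift hM hV h ha
  linarith [bellman_le (M := M) (V := V) ha']

/-- The Bellman operator of the problem stopped with probability `1 - b` at each stage, with the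
potential as terminal cost. -/
noncomputable def Model.stoppedBellman (M : Model N B E S D) (b : ℝ)
    (V : SystemState N B E S D → ℝ) : SystemState N B E S D → ℝ :=
  M.bellman fun x => b * V x + (1 - b) * M.potential x

lemma stoppedBellman_le_add {b : ℝ} (hb : 0 ≤ b) (V W : SystemState N B E S D → ℝ)
    (x : SystemState N B E S D) :
    M.stoppedBellman b V x ≤ M.stoppedBellman b W x + b * dist V W := by
  obtain ⟨a, ha, hWa⟩ := exists_bellman_eq (M := M)
    (fun x => b * W x + (1 - b) * M.potential x) x
  refine (bellman_le ha).trans ?_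
  rw [Model.stoppedBellman, hWa]
  unfold Model.actionValue
  rw [add_assoc]
  gcongr
  have : expect (M.step x a) (fun x => b * V x + (1 - b) * M.potential x) ≤
      expect (M.step x a) fun y => (b * W y + (1 - b) * M.potential y) + b * dist V W := by
    refine expect_mono _ fun y => ?_
    have h1 : V y - W y ≤ dist V W :=
      (le_abs_self _).trans ((Real.dist_eq (V y) (W y)) ▸ dist_le_pi_dist V W y)
    nlinarith [mul_le_mul_of_nonneg_left h1 hb]
  rwa [expect_add _ (fun y => b * W y + (1 - b) * M.potential y), expect_const] at this

/-- The stopped problem has a value function that respects all shifts. -/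
lemma exists_stoppedBellman_fixedPoint (hM : M.ConvexPenalty) {b : ℝ} (hb0 : 0 ≤ b) (hb1 : b < 1) :
    ∃ V ∈ shiftMonotone M, M.stoppedBellman b V = V := by
  have hlip : LipschitzWith ⟨b, hb0⟩ (M.stoppedBellman b) := by
    refine LipschitzWith.of_dist_le_mul fun V W => ?_
    refine (dist_pi_le_iff (mul_nonneg hb0 dist_nonneg)).2 fun x => ?_
    rw [Real.dist_eq, abs_le]
    have h1 := stoppedBellman_le_add (M := M) hb0 V W x
    have h2 := stoppedBellman_le_add (M := M) hb0 W V x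
    rw [dist_comm W V] at h2
    change -(b * dist V W) ≤ _ ∧ _ ≤ b * dist V W
    constructor <;> linarith
  have hcontr : ContractingWith ⟨b, hb0⟩ (M.stoppedBellman b) := ⟨by exact_mod_cast hb1, hlip⟩
  refine ⟨hcontr.fixedPoint, ?_, hcontr.fixedPoint_isFixedPt⟩
  refine (isClosed_shiftMonotone M).mem_of_tendsto (hcontr.tendsto_iterate_fixedPoint M.potential)
    (Eventually.of_forall fun n => ?_)
  induction n with
  | zero => exact potential_mem_shiftMonotone hM
  | succ n ih =>
    rw [Function.iterate_succ_apply']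
    exact bellman_mem_shiftMonotone hM
      (shiftMonotone_convex_comb ih (potential_mem_shiftMonotone hM) hb0 hb1.le)

/-- A cost-to-go that respects all shifts has a greedy policy that respects priorities. -/
lemma exists_greedy_priority (hM : M.ConvexPenalty) {V : SystemState N B E S D → ℝ}
    (hV : V ∈ shiftMonotone M) : ∃ μ : SystemState N B E S D → Action N,
      (∀ x, Feasible x (μ x)) ∧ (∀ x i j, μ x i = 1 → Priority x i j → μ x j = 1) ∧
      ∀ x, M.bellman V x = M.actionValue V x (μ x) := by
  classical
  have key : ∀ x, ∃ a, Feasible x a ∧ (∀ i j, a i = 1 → Priority x i j → a j = 1) ∧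
      M.bellman V x = M.actionValue V x a := by
    intro x
    -- A minimizer of maximal priority weight admits no violation: an interchange would give a
    -- minimizer of larger weight.
    set F := Finset.univ.filter fun a => Feasible x a ∧ M.bellman V x = M.actionValue V x a
    have hF : F.Nonempty := by
      obtain ⟨a, ha⟩ := exists_bellman_eq (M := M) V x
      exact ⟨a, by simpa [F] using ha⟩
    obtain ⟨a, haF, hmax⟩ := F.exists_max_image (priorityWeight x) hF
    obtain ⟨ha, hVa⟩ : Feasible x a ∧ M.bellman V x = M.actionValue V x a := by
      simpa [F] using haF
    refine ⟨a, ha, fun i j hi hp => ?_, hVa⟩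
    by_contra hj
    have hi' : (a i : ℕ) = 1 := by rw [hi]; rfl
    have hj' : (a j : ℕ) = 0 := by omega
    obtain ⟨hfeas, hle⟩ := actionValue_comp_swap_le hM hV ha hp hi' hj'
    have hmem : (fun k => a (Equiv.swap i j k)) ∈ F := by
      simp only [F, Finset.mem_filter, Finset.mem_univ, true_and]
      exact ⟨hfeas, le_antisymm (bellman_le hfeas) (hVa ▸ hle)⟩
    exact absurd (hmax _ hmem) (not_le.2 (priorityWeight_lt_comp_swap hp hi' hj'))
  choose μ h1 h2 h3 using key
  exact ⟨μ, h1, h2, h3⟩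

end Bellman

/-! ### From stopped values to average costs -/

section AverageCost

variable {N B E : ℕ} {S D : Type*} [Fintype S] [Fintype D] {M : Model N B E S D}

/-- Expected stage cost at stage `t`. -/
noncomputable def Model.meanCost (M : Model N B E S D) (π : Policy N B E S D)
    (x₀ : SystemState N B E S D) (t : ℕ) : ℝ :=
  expect (M.stateLaw π x₀ t) fun x => M.stageCost x (π t x)

lemma expectedCost_eq_sum_meanCost (π : Policy N B E S D) (x₀ : SystemState N B E S D) (T : ℕ) :
    M.expectedCost π x₀ T = ∑ t ∈ Finset.range T, M.meanCost π x₀ t := rfl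

lemma expect_stateLaw_succ (π : Policy N B E S D) (x₀ : SystemState N B E S D) (t : ℕ)
    (f : SystemState N B E S D → ℝ) :
    expect (M.stateLaw π x₀ (t + 1)) f =
      expect (M.stateLaw π x₀ t) fun x => expect (M.step x (π t x)) f :=
  expect_bind _ _ _

lemma exists_abs_expectedCost_le (M : Model N B E S D) : ∃ G, ∀ (π : Policy N B E S D) x₀ (T : ℕ),
    |M.expectedCost π x₀ T| ≤ T * G := by
  obtain ⟨G, hG⟩ := exists_abs_le
    fun p : SystemState N B E S D × Action N => M.stageCost p.1 p.2
  refine ⟨G, fun π x₀ T => ?_⟩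
  rw [expectedCost_eq_sum_meanCost]
  refine (Finset.abs_sum_le_sum_abs _ _).trans ?_
  refine (Finset.sum_le_card_nsmul _ _ G fun t _ =>
    abs_expect_le _ fun x => hG (x, π t x)).trans ?_
  simp

/-- Expectation of the value of an action along a trajectory of the stopped problem. -/
lemma expect_actionValue_stopped (π : Policy N B E S D) (x₀ : SystemState N B E S D) (t : ℕ)
    (b : ℝ) (V : SystemState N B E S D → ℝ) :
    expect (M.stateLaw π x₀ t)
        (fun x => M.actionValue (fun y => b * V y + (1 - b) * M.potential y) x (π t x)) =
      M.meanCost π x₀ t + b * expect (M.stateLaw π x₀ (t + 1)) V +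
        (1 - b) * expect (M.stateLaw π x₀ (t + 1)) M.potential := by
  simp only [Model.actionValue, expect_add, expect_const_mul, expect_stateLaw_succ, Model.meanCost]
  ring

/-- The value of the stopped problem is a lower bound for the slope of the costs of a policy. -/
lemma stoppedValue_le {b K J Q : ℝ} (hb0 : 0 ≤ b) (hb1 : b < 1)
    {V : SystemState N B E S D → ℝ} (hV : M.stoppedBellman b V = V)
    (hQ : ∀ x, |M.potential x| ≤ Q) {π : Policy N B E S D} (hπ : ∀ t x, Feasible x (π t x))
    (x₀ : SystemState N B E S D) (hK : ∀ T : ℕ, M.expectedCost π x₀ T ≤ K + T * J) :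
    (1 - b) * V x₀ ≤ (1 - b) * (K + Q) + J := by
  obtain ⟨C, hC⟩ := exists_abs_le V
  -- The terminal cost, at most `Q`, is spread as `(1 - b) * Q` per stage and vanishes in the limit.
  have := discounted_le_of_partial_sums_le (e := fun t => expect (M.stateLaw π x₀ t) V)
    (c := fun t => M.meanCost π x₀ t + (1 - b) * Q) (J := J + (1 - b) * Q) (K := K) hb0 hb1
    (fun t => ?_) (fun t => abs_expect_le _ hC) (fun T => ?_)
  · simp only [Model.stateLaw, expect_pure] at this
    linarith
  · have h1 : expect (M.stateLaw π x₀ t) V ≤ expect (M.stateLaw π x₀ t)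
        (fun x => M.actionValue (fun y => b * V y + (1 - b) * M.potential y) x (π t x)) :=
      expect_mono _ fun x => (congrFun hV x).symm.le.trans (bellman_le (hπ t x))
    rw [expect_actionValue_stopped] at h1
    have h2 := (abs_le.1 (abs_expect_le (M.stateLaw π x₀ (t + 1)) hQ)).2
    nlinarith [mul_le_mul_of_nonneg_left h2 (sub_nonneg.2 hb1.le)]
  · rw [Finset.sum_add_distrib, ← expectedCost_eq_sum_meanCost]
    simp only [Finset.sum_const, Finset.card_range, nsmul_eq_mul]
    linarith [hK T]

/-- A greedy stationary policy of the stopped problem costs no more than its value. -/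
lemma le_stoppedValue {b K J Q : ℝ} (hb0 : 0 ≤ b) (hb1 : b < 1)
    {V : SystemState N B E S D → ℝ} (hV : M.stoppedBellman b V = V)
    (hQ : ∀ x, |M.potential x| ≤ Q) {μ : SystemState N B E S D → Action N}
    (hμ : ∀ x, M.stoppedBellman b V x =
      M.actionValue (fun y => b * V y + (1 - b) * M.potential y) x (μ x))
    (x₀ : SystemState N B E S D)
    (hK : ∀ T : ℕ, T * J - K ≤ M.expectedCost (fun _ => μ) x₀ T) :
    J - (1 - b) * (K + Q) ≤ (1 - b) * V x₀ := by
  obtain ⟨C, hC⟩ := exists_abs_le V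
  -- The same estimate for `-V`, available because greediness makes the Bellman inequality an
  -- equality.
  have := discounted_le_of_partial_sums_le
    (e := fun t => -expect (M.stateLaw (fun _ => μ) x₀ t) V)
    (c := fun t => -M.meanCost (fun _ => μ) x₀ t + (1 - b) * Q) (J := -J + (1 - b) * Q) (K := K)
    hb0 hb1 (fun t => ?_) (fun t => (abs_neg _).trans_le (abs_expect_le _ hC)) (fun T => ?_)
  · simp only [Model.stateLaw, expect_pure] at this
    linarith
  · have h1 : expect (M.stateLaw (fun _ => μ) x₀ t) V = expect (M.stateLaw (fun _ => μ) x₀ t)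
        (fun x => M.actionValue (fun y => b * V y + (1 - b) * M.potential y) x (μ x)) := by
      congr 1
      funext x
      rw [← hμ x, hV]
    rw [expect_actionValue_stopped (fun _ => μ)] at h1
    have h2 := (abs_le.1 (abs_expect_le (M.stateLaw (fun _ => μ) x₀ (t + 1)) hQ)).1
    nlinarith [mul_le_mul_of_nonneg_left h2 (sub_nonneg.2 hb1.le)]
  · rw [Finset.sum_add_distrib, Finset.sum_neg_distrib, ← expectedCost_eq_sum_meanCost]
    simp only [Finset.sum_const, Finset.card_range, nsmul_eq_mul]
    linarith [hK T]

/-- The expected costs of a stationary policy are linear in time up to a bounded error, and the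
slope is its average cost. -/
lemma exists_abs_expectedCost_sub_averageCost_le (μ : SystemState N B E S D → Action N)
    (x₀ : SystemState N B E S D) :
    ∃ K, ∀ T : ℕ, |M.expectedCost (fun _ => μ) x₀ T - T * M.averageCost (fun _ => μ) x₀| ≤ K := by
  -- The harmonic part has constant expectation along the chain and gives the slope; the coboundary
  -- telescopes.
  obtain ⟨h, f, hh, hf⟩ := exists_harmonic_add_coboundary (fun x => M.step x (μ x))
    fun x => M.stageCost x (μ x)
  have hharm : ∀ t, expect (M.stateLaw (fun _ => μ) x₀ t) h = h x₀ := by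
    intro t
    induction t with
    | zero => exact expect_pure _ _
    | succ t ih =>
      rw [expect_stateLaw_succ]
      simp only [hh, ih]
  have hmean : ∀ t, M.meanCost (fun _ => μ) x₀ t = h x₀ +
      (expect (M.stateLaw (fun _ => μ) x₀ t) f - expect (M.stateLaw (fun _ => μ) x₀ (t + 1)) f) := by
    intro t
    rw [expect_stateLaw_succ, ← hharm t, Model.meanCost]
    simp only [hf, expect_sub, expect_add]
    ring
  have hcost : ∀ T : ℕ, M.expectedCost (fun _ => μ) x₀ T =
      T * h x₀ + (f x₀ - expect (M.stateLaw (fun _ => μ) x₀ T) f) := by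
    intro T
    rw [expectedCost_eq_sum_meanCost, Finset.sum_congr rfl fun t _ => hmean t,
      Finset.sum_add_distrib, Finset.sum_range_sub']
    simp [Model.stateLaw, expect_pure]
  obtain ⟨K, hK⟩ := exists_abs_le f
  have hbound : ∀ T : ℕ, |M.expectedCost (fun _ => μ) x₀ T - T * h x₀| ≤ 2 * K := by
    intro T
    rw [hcost, add_sub_cancel_left]
    refine (abs_sub _ _).trans ?_
    linarith [hK x₀, abs_expect_le (M.stateLaw (fun _ => μ) x₀ T) hK]
  have hlim : Tendsto (fun T : ℕ => 1 / (T : ℝ) * M.expectedCost (fun _ => μ) x₀ T) atTop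
      (𝓝 (h x₀)) := by
    rw [tendsto_iff_dist_tendsto_zero]
    refine squeeze_zero' (Eventually.of_forall fun _ => dist_nonneg) (g := fun T : ℕ => 2 * K / T)
      ?_ (tendsto_const_div_atTop_nhds_zero_nat (2 * K))
    filter_upwards [eventually_gt_atTop 0] with T hT
    have hT' : (0 : ℝ) < T := by exact_mod_cast hT
    have hsplit : 1 / (T : ℝ) * M.expectedCost (fun _ => μ) x₀ T - h x₀ =
        (M.expectedCost (fun _ => μ) x₀ T - T * h x₀) / T := by
      field_simp
    rw [Real.dist_eq, hsplit, abs_div, abs_of_pos hT']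
    exact div_le_div_of_nonneg_right (hbound T) hT'.le
  refine ⟨2 * K, fun T => ?_⟩
  rw [Model.averageCost, hlim.limsup_eq]
  exact hbound T

/-- A stationary policy that is greedy for stopped problems with stopping probabilities
arbitrarily close to zero is optimal for the average cost. -/
lemma isOptimalStationary_of_frequently_greedy {μ : SystemState N B E S D → Action N}
    (hfeas : ∀ x, Feasible x (μ x))
    (hμ : ∀ ε > 0, ∃ b : ℝ, 0 ≤ b ∧ b < 1 ∧ 1 - b < ε ∧ ∃ V, M.stoppedBellman b V = V ∧
      ∀ x, M.stoppedBellman b V x =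
        M.actionValue (fun y => b * V y + (1 - b) * M.potential y) x (μ x)) :
    M.IsOptimalStationary μ := by
  refine ⟨hfeas, fun π hπ x₀ => ?_⟩
  obtain ⟨K, hK⟩ := exists_abs_expectedCost_sub_averageCost_le (M := M) μ x₀
  obtain ⟨G, hG⟩ := exists_abs_expectedCost_le M
  obtain ⟨Q, hQ⟩ := exists_abs_le M.potential
  refine le_of_forall_pos_le_add fun ε hε => ?_
  obtain ⟨K', hK'⟩ := exists_affine_bound_of_limsup_lt (S := M.expectedCost π x₀)
    (J := M.averageCost π x₀ + ε / 2) (hG π x₀) (lt_add_of_pos_right _ (half_pos hε))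
  -- Chosen so that `1 - b < ε / 2 / R` brings all error constants below the other half of `ε`.
  set R := |K + Q + (K' + Q)| + 1 with hR
  have hRpos : 0 < R := by positivity
  obtain ⟨b, hb0, hb1, hbε, V, hV, hgreedy⟩ := hμ (ε / 2 / R) (by positivity)
  have h1 := stoppedValue_le hb0 hb1 hV hQ hπ x₀ hK'
  have h2 := le_stoppedValue hb0 hb1 hV hQ hgreedy x₀ (K := K)
    (J := M.averageCost (fun _ => μ) x₀) fun T => by linarith [(abs_le.1 (hK T)).1]
  rw [lt_div_iff₀ hRpos] at hbε
  have h3 : (1 - b) * (K + Q + (K' + Q)) ≤ (1 - b) * R :=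
    mul_le_mul_of_nonneg_left (by linarith [le_abs_self (K + Q + (K' + Q))]) (by linarith)
  linarith

end AverageCost

/-! ### Vanishing stopping probability -/

/-- There is a priority-respecting optimal stationary policy. The average cost may depend on the
initial state: no recurrence hypothesis is used, since the cost-to-go functions of the stopped
problems play the role of a solution of the average-cost optimality equation. -/
lemma exists_optimal_priority {N B E : ℕ} {S D : Type*} [Fintype S] [Fintype D]
    {M : Model N B E S D} (hM : M.ConvexPenalty) :
    ∃ μ : SystemState N B E S D → Action N, M.IsOptimalStationary μ ∧
      ∀ x i j, μ x i = 1 → Priority x i j → μ x j = 1 := by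
  classical
  have hstage : ∀ n : ℕ, ∃ μ : SystemState N B E S D → Action N,
      (∀ x, Feasible x (μ x)) ∧ (∀ x i j, μ x i = 1 → Priority x i j → μ x j = 1) ∧
      ∃ b : ℝ, 0 ≤ b ∧ b < 1 ∧ 1 - b = 1 / ((n : ℝ) + 1) ∧ ∃ V, M.stoppedBellman b V = V ∧
        ∀ x, M.stoppedBellman b V x =
          M.actionValue (fun y => b * V y + (1 - b) * M.potential y) x (μ x) := by
    intro n
    have hpos : (0 : ℝ) < 1 / ((n : ℝ) + 1) := by positivity
    have hle : 1 / ((n : ℝ) + 1) ≤ 1 := by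
      rw [div_le_one (by positivity)]
      linarith [n.cast_nonneg (α := ℝ)]
    obtain ⟨V, hVmem, hV⟩ := exists_stoppedBellman_fixedPoint hM
      (b := 1 - 1 / ((n : ℝ) + 1)) (by linarith) (by linarith)
    obtain ⟨μ, h1, h2, h3⟩ := exists_greedy_priority hM (shiftMonotone_convex_comb hVmem
      (potential_mem_shiftMonotone hM) (b := 1 - 1 / ((n : ℝ) + 1)) (by linarith) (by linarith))
    exact ⟨μ, h1, h2, 1 - 1 / ((n : ℝ) + 1), by linarith, by linarith, by ring, V, hV, h3⟩
  choose μ h1 h2 h3 using hstage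
  -- Pigeonhole: one policy is greedy for infinitely many stopping probabilities `1 / (n + 1)`.
  obtain ⟨μ₀, hinf⟩ := Finite.exists_infinite_fiber μ
  rw [Set.infinite_coe_iff] at hinf
  obtain ⟨n₀, hn₀⟩ := hinf.nonempty
  obtain rfl : μ n₀ = μ₀ := hn₀
  refine ⟨μ n₀, isOptimalStationary_of_frequently_greedy (h1 n₀) fun ε hε => ?_, h2 n₀⟩
  obtain ⟨m, hm⟩ := exists_nat_one_div_lt hε
  obtain ⟨n, hn, hmn⟩ := hinf.exists_gt m
  obtain ⟨b, hb0, hb1, hb, V, hV, hgreedy⟩ := h3 n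
  have hnμ : μ n = μ n₀ := hn
  rw [hnμ] at hgreedy
  refine ⟨b, hb0, hb1, ?_, V, hV, hgreedy⟩
  rw [hb]
  refine lt_of_le_of_lt (one_div_le_one_div_of_le (by positivity) ?_) hm
  have : (m : ℝ) ≤ n := by exact_mod_cast hmn.le
  linarith

end EVCharging

theorem theorem2 {N B E : ℕ} {S D : Type*} [Fintype S] [Fintype D]
    (M : EVCharging.Model N B E S D)
    (hconvex : M.ConvexPenalty)
    (harrival : M.NoArrivalPossible)
    (hgrid : M.GridReachable)
    (hdemand : M.DemandErgodic) :
    ∃ μ : EVCharging.SystemState N B E S D → EVCharging.Action N,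
      M.IsOptimalStationary μ ∧
      ∀ x i j, μ x i = 1 → EVCharging.Priority x i j → μ x j = 1 :=
  EVCharging.exists_optimal_priority hconvex
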